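/- Let $T=(V,E)$ be a locally finite tree. For $p\in[0,1]$ let $P_p$ be the law of Bernoulli bond percolation on $T$, in which every edge is open with probability $p$ independently of the others, and let $$p_c=\sup\{p\in[0,1] : P_p(\text{there is an infinite open cluster})=0\}.$$ For couplings $J=(J_e)_{e\in E}\in\mathbb R^E$, a spin configuration $\sigma\in\{-1,+1\}^V$ is called a ground state if for every finite $B\subset V$ $$\sum_{\{x,y\}\in\partial B}J_{xy}\sigma_x\sigma_y\ge 0,$$ where $\partial B$ is the set of edges with exactly one end in $B$. Let $\mathcal G(J)$ be the set of all ground states. Assume that $p_c<1$, and let $\nu$ be a probability measure on $\mathbb R$ with $\nu(\{0\})=0$ and $\nu((-\epsilon,\epsilon))>0$ for every $\epsilon>0$. If the couplings $(J_e)_{e\in E}$ are i.i.d. with law $\nu$, that is, if $J$ has law $\nu^{E}$, then $|\mathcal G(J)|=\infty$ almost surely. -/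

import Mathlib

open MeasureTheory ProbabilityTheory Set

noncomputable section

namespace SpinGlass

variable {V : Type*}

/-- The value `σ x * σ y ∈ {-1, +1}` on an edge `e = {x, y}`, as a real number. -/
def edgeSpin (σ : V → ℤˣ) (e : Sym2 V) : ℝ :=
  (((e.map σ).mul : ℤˣ) : ℤ)

/-- The set `∂B` of edges of `G` with exactly one end in `B`. -/
def edgeBoundary (G : SimpleGraph V) (B : Finset V) : Set G.edgeSet :=
  {e | ∃ x y : V, x ∈ B ∧ y ∉ B ∧ (e : Sym2 V) = s(x, y)}

/-- In a locally finite graph `∂B` is finite, so that the `finsum` over `∂B` below is an honest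
finite sum. -/
theorem edgeBoundary_finite (G : SimpleGraph V) [G.LocallyFinite] (B : Finset V) :
    (edgeBoundary G B).Finite := by
  have hfin : (⋃ x ∈ B, (fun y => s(x, y)) '' G.neighborSet x).Finite :=
    B.finite_toSet.biUnion fun x _ => (G.neighborSet x).toFinite.image _
  refine Set.Finite.of_finite_image (f := Subtype.val) (hfin.subset ?_)
    Subtype.val_injective.injOn
  rintro _ ⟨⟨e, he⟩, ⟨x, y, hx, -, rfl⟩, rfl⟩
  simp only [Set.mem_iUnion]
  exact ⟨x, hx, y, he, rfl⟩

/-- `σ` is a ground state of `G` with couplings `J`: for every finite set `B` of vertices,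
`∑_{xy ∈ ∂B} J_{xy} σ_x σ_y ≥ 0`. -/
def IsGroundState (G : SimpleGraph V) (J : G.edgeSet → ℝ) (σ : V → ℤˣ) : Prop :=
  ∀ B : Finset V, 0 ≤ ∑ᶠ e ∈ edgeBoundary G B, J e * edgeSpin σ e

/-- The set of ground states of `G` with couplings `J`. -/
def groundStates (G : SimpleGraph V) (J : G.edgeSet → ℝ) : Set (V → ℤˣ) :=
  {σ | IsGroundState G J σ}

/-- The law `ν^E` of i.i.d. couplings with distribution `ν` on the edges of `G`. -/
def couplingLaw (G : SimpleGraph V) (ν : Measure ℝ) [IsProbabilityMeasure ν] :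
    Measure (G.edgeSet → ℝ) :=
  Measure.infinitePi fun _ => ν

/-- The law of bond percolation with parameter `p` on `G`: each edge is, independently, open
(`true`) with probability `p` and closed (`false`) with probability `1 - p`. -/
def percolationLaw (G : SimpleGraph V) (p : unitInterval) : Measure (G.edgeSet → Bool) :=
  Measure.infinitePi fun _ => bernoulliMeasure true false p

/-- The subgraph formed by the open edges. -/
def openSubgraph (G : SimpleGraph V) (ω : G.edgeSet → Bool) : SimpleGraph V :=
  SimpleGraph.fromEdgeSet {e | ∃ he : e ∈ G.edgeSet, ω ⟨e, he⟩ = true}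

/-- There is an infinite open cluster. -/
def HasInfiniteCluster (G : SimpleGraph V) (ω : G.edgeSet → Bool) : Prop :=
  ∃ x : V, {y | (openSubgraph G ω).Reachable x y}.Infinite

/-- The critical probability for bond percolation on `G`,
`p_c = sup {p ∈ [0, 1] : P_p(there is an infinite open cluster) = 0}`. -/
def criticalProbability (G : SimpleGraph V) : unitInterval :=
  sSup {p | percolationLaw G p {ω | HasInfiniteCluster G ω} = 0}

end SpinGlass

end

/-! On a tree any prescription of edge signs comes from spins (`exists_gauge`). So some σ₀ satisfies
every edge, and flipping σ₀ on one side of an edge e changes the sign of e alone. The flipped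
configuration is still a ground state when each end of e lies in an infinite subgraph avoiding e
with couplings at least |J_e|: a finite B cut by e also cuts such an edge, which pays for e
(`isGroundState_of_wall`).

Choose δ so that the edges with |J| ≥ δ form Bernoulli percolation with p_c < p < 1. On the path
between two infinite clusters of these edges, the weakest edge is such an e, so some ground state
separates the clusters (`exists_groundState_separating`). Infinitely many clusters thus force
infinitely many ground states.

That there are infinitely many clusters is `ae_exists_infinite_clusters`. Fat vertices must branch,
since a single ray of them would almost surely contain a closed edge; this gives fat vertices b_n
with disjoint sets of descendants. By a zero-one law each b_n almost surely has an infinite cluster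
among its descendants, and infinitely many of the edges above the b_n are closed. -/

noncomputable section

namespace SpinGlass

variable {V : Type*}

/-! ### Gauges and ground states with one flipped edge -/

@[simp]
theorem edgeSpin_mk (σ : V → ℤˣ) (x y : V) :
    edgeSpin σ s(x, y) = ((σ x * σ y : ℤˣ) : ℤ) := rfl

theorem abs_edgeSpin (σ : V → ℤˣ) (e : Sym2 V) : |edgeSpin σ e| = 1 := by
  unfold edgeSpin
  rcases Int.units_eq_one_or ((e.map σ).mul) with h | h <;> simp [h]

/-- On a tree every choice of edge signs is the product of the spins at the two ends. -/
theorem exists_gauge {G : SimpleGraph V} (hG : G.IsTree) (h : Sym2 V → ℤˣ) :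
    ∃ σ : V → ℤˣ, ∀ x y, G.Adj x y → σ x * σ y = h s(x, y) := by
  obtain ⟨r⟩ := hG.connected.nonempty
  choose P hP _ using hG.existsUnique_path r
  have key : ∀ x y, G.Adj x y → x ∈ (P y).support →
      ((P x).edges.map h).prod * ((P y).edges.map h).prod = h s(x, y) := by
    intro x y hxy hmem
    rw [hG.isAcyclic.path_concat (hP x) (hP y) hxy hmem]
    simp only [SimpleGraph.Walk.edges_concat, List.concat_eq_append, List.map_append,
      List.prod_append, List.map_cons, List.map_nil, List.prod_singleton]
    rw [← mul_assoc, Int.units_mul_self, one_mul]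
  -- The spin at v is the product of the signs along the path from the root; of two adjacent
  -- vertices, one has a path extending that of the other by a single edge.
  refine ⟨fun v => ((P v).edges.map h).prod, fun x y hxy => ?_⟩
  by_cases hmem : x ∈ (P y).support
  · exact key x y hxy hmem
  · have := hG.isAcyclic.mem_support_of_ne_mem_support_of_adj_of_isPath (hP x) (hP y) hxy hmem
    rw [mul_comm, Sym2.eq_swap]
    exact key y x hxy.symm this

theorem mul_eq_prod_edges {G : SimpleGraph V} {σ : V → ℤˣ} {h : Sym2 V → ℤˣ}
    (hσ : ∀ x y, G.Adj x y → σ x * σ y = h s(x, y)) {u v : V} (p : G.Walk u v) :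
    σ u * σ v = (p.edges.map h).prod := by
  induction p with
  | nil => simp [Int.units_mul_self]
  | @cons u w v huw p ih =>
    rw [SimpleGraph.Walk.edges_cons, List.map_cons, List.prod_cons, ← ih, ← hσ u w huw, mul_assoc,
      ← mul_assoc (σ w), Int.units_mul_self, one_mul]

/-- A walk that crosses the edge `e` once splits at `e`. -/
theorem exists_reachable_of_mem_edges {G H : SimpleGraph V} {e : Sym2 V} {u v : V}
    (p : G.Walk u v) (hp : p.edges.Nodup) (he : e ∈ p.edges)
    (hH : ∀ f ∈ p.edges, f ≠ e → f ∈ H.edgeSet) :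
    ∃ x y, e = s(x, y) ∧ H.Reachable u x ∧ H.Reachable y v := by
  induction p with
  | nil => simp at he
  | @cons u w v huw p ih =>
    rw [SimpleGraph.Walk.edges_cons, List.nodup_cons] at hp
    rw [SimpleGraph.Walk.edges_cons] at he hH
    by_cases h : e = s(u, w)
    · refine ⟨u, w, h, .rfl, ⟨p.transfer H fun f hf => hH f (List.mem_cons_of_mem _ hf) ?_⟩⟩
      rintro rfl
      exact hp.1 (h ▸ hf)
    · obtain ⟨x, y, hxy, h1, h2⟩ := ih hp.2 ((List.mem_cons.1 he).resolve_left h)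
        fun f hf => hH f (List.mem_cons_of_mem _ hf)
      have : H.Adj u w := hH s(u, w) (by simp) (Ne.symm h)
      exact ⟨x, y, hxy, this.reachable.trans h1, h2⟩

/-- A configuration satisfying every edge but `e` is a ground state if both ends of `e` lie in
infinite components of a subgraph whose edges have couplings at least as large as that of `e`. -/
theorem isGroundState_of_wall {G H : SimpleGraph V} [G.LocallyFinite] {J : G.edgeSet → ℝ}
    {σ : V → ℤˣ} {e : G.edgeSet} {x y : V} (he : (e : Sym2 V) = s(x, y))
    (hsat : ∀ f ≠ e, J f * edgeSpin σ f = |J f|)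
    (hH : ∀ f ∈ H.edgeSet, ∃ hf : f ∈ G.edgeSet, (⟨f, hf⟩ : G.edgeSet) ≠ e ∧ |J e| ≤ |J ⟨f, hf⟩|)
    (hx : {z | H.Reachable x z}.Infinite) (hy : {z | H.Reachable y z}.Infinite) :
    IsGroundState G J σ := by
  intro B
  have hfin := edgeBoundary_finite G B
  by_cases heB : e ∈ edgeBoundary G B
  · obtain ⟨f, hfB, hfe, hef⟩ : ∃ f ∈ edgeBoundary G B, f ≠ e ∧ |J e| ≤ |J f| := by
      obtain ⟨a, b, ha, hb, hab⟩ := heB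
      have hinf : {z | H.Reachable a z}.Infinite := by
        rw [he, Sym2.eq_iff] at hab
        rcases hab with ⟨rfl, rfl⟩ | ⟨rfl, rfl⟩
        · exact hx
        · exact hy
      obtain ⟨z, ⟨p⟩, hzB⟩ := hinf.exists_notMem_finset B
      -- The infinite component of a must leave the finite set B, through an edge other than e.
      obtain ⟨d, -, hd1, hd2⟩ := p.exists_boundary_dart (↑B) ha hzB
      obtain ⟨hf, hne, hle⟩ := hH _ d.edge_mem
      exact ⟨⟨d.edge, hf⟩, ⟨d.fst, d.snd, hd1, hd2, rfl⟩, hne, hle⟩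
    classical
    rw [finsum_mem_eq_finite_toFinset_sum _ hfin,
      ← Finset.add_sum_erase _ _ (hfin.mem_toFinset.2 heB),
      ← Finset.add_sum_erase _ _ (Finset.mem_erase.2 ⟨hfe, hfin.mem_toFinset.2 hfB⟩)]
    have h1 : -|J e| ≤ J e * edgeSpin σ e := by
      have := neg_abs_le (J e * edgeSpin σ e)
      rwa [abs_mul, abs_edgeSpin, mul_one] at this
    have h2 := hsat f hfe
    have h3 : 0 ≤ ∑ g ∈ (hfin.toFinset.erase e).erase f, J g * edgeSpin σ g := by
      refine Finset.sum_nonneg fun g hg => ?_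
      rw [hsat g (Finset.ne_of_mem_erase (Finset.mem_of_mem_erase hg))]
      exact abs_nonneg _
    linarith
  · rw [finsum_mem_eq_finite_toFinset_sum _ hfin]
    refine Finset.sum_nonneg fun f hf => ?_
    rw [hsat f (by rintro rfl; exact heB (hfin.mem_toFinset.1 hf))]
    exact abs_nonneg _

theorem prod_map_ite_eq_neg_one {α : Type*} [DecidableEq α] {e : α} {l : List α} (hl : l.Nodup)
    (he : e ∈ l) : (l.map fun f => if f = e then (-1 : ℤˣ) else 1).prod = -1 := by
  rw [List.prod_map_ite_eq, List.count_eq_one_of_mem hl he]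
  simp

/-! ### From infinite clusters of strong edges to ground states -/

/-- The configuration of edges with couplings of size at least `δ`. -/
def strongEdges {G : SimpleGraph V} (δ : ℝ) (J : G.edgeSet → ℝ) : G.edgeSet → Bool :=
  fun e => decide (δ ≤ |J e|)

theorem mem_edgeSet_openSubgraph {G : SimpleGraph V} {ω : G.edgeSet → Bool} {e : Sym2 V} :
    e ∈ (openSubgraph G ω).edgeSet ↔ ∃ he : e ∈ G.edgeSet, ω ⟨e, he⟩ = true := by
  rw [openSubgraph, SimpleGraph.edgeSet_fromEdgeSet]
  refine ⟨fun h => h.1, fun h => ⟨h, fun hd => ?_⟩⟩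
  exact G.not_isDiag_of_mem_edgeSet h.1 hd

/-- Two distinct infinite clusters of strong edges are separated by a ground state. -/
theorem exists_groundState_separating {G : SimpleGraph V} [G.LocallyFinite] (hG : G.IsTree)
    {J : G.edgeSet → ℝ} {δ : ℝ} {σ₀ : V → ℤˣ} (hσ₀ : ∀ f, J f * edgeSpin σ₀ f = |J f|) {c d : V}
    (hc : {z | (openSubgraph G (strongEdges δ J)).Reachable c z}.Infinite)
    (hd : {z | (openSubgraph G (strongEdges δ J)).Reachable d z}.Infinite)
    (hcd : ¬ (openSubgraph G (strongEdges δ J)).Reachable c d) :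
    ∃ σ ∈ groundStates G J, σ c * σ₀ c ≠ σ d * σ₀ d := by
  classical
  obtain ⟨p, hp, -⟩ := hG.existsUnique_path c d
  have hpe : p.edges.Nodup := hp.isTrail.edges_nodup
  let w : Sym2 V → ℝ := fun f => if hf : f ∈ G.edgeSet then |J ⟨f, hf⟩| else 0
  have hw : ∀ f : G.edgeSet, w f = |J f| := fun f => dif_pos f.2
  have hne : p.edges.toFinset.Nonempty := by
    cases p with
    | nil => exact absurd .rfl hcd
    | cons h q => simp
  -- The wall is put at the weakest edge of the path from c to d.
  obtain ⟨e, hep, hmin⟩ := Finset.exists_min_image _ w hne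
  rw [List.mem_toFinset] at hep
  simp only [List.mem_toFinset] at hmin
  have heG := p.edges_subset_edgeSet hep
  obtain ⟨e, rfl⟩ : ∃ e' : G.edgeSet, (e' : Sym2 V) = e := ⟨⟨e, heG⟩, rfl⟩
  have hlt : |J e| < δ := by
    by_contra! hle
    refine hcd ⟨p.transfer _ fun f hf => ?_⟩
    have hfG := p.edges_subset_edgeSet hf
    have h1 := hmin f hf
    rw [hw, hw ⟨f, hfG⟩] at h1
    exact mem_edgeSet_openSubgraph.2 ⟨hfG, by simpa [strongEdges] using hle.trans h1⟩
  -- H contains both the strong clusters and the rest of the path, hence joins each end of e to an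
  -- infinite cluster.
  let H := SimpleGraph.fromEdgeSet {f | f ∈ G.edgeSet ∧ f ≠ e ∧ |J e| ≤ w f}
  have hH : ∀ f, f ∈ H.edgeSet ↔ f ∈ G.edgeSet ∧ f ≠ e ∧ |J e| ≤ w f := by
    intro f
    rw [SimpleGraph.edgeSet_fromEdgeSet]
    exact ⟨fun h => h.1, fun h => ⟨h, fun hd => G.not_isDiag_of_mem_edgeSet h.1 hd⟩⟩
  have hle : openSubgraph G (strongEdges δ J) ≤ H := by
    rw [← SimpleGraph.edgeSet_subset_edgeSet]
    intro f hf
    obtain ⟨hfG, hf⟩ := mem_edgeSet_openSubgraph.1 hf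
    have hf : δ ≤ |J ⟨f, hfG⟩| := by simpa [strongEdges] using hf
    refine (hH f).2 ⟨hfG, ?_, ?_⟩
    · rintro rfl
      exact absurd hf (not_le.2 hlt)
    · rw [hw ⟨f, hfG⟩]
      exact hlt.le.trans hf
  obtain ⟨x, y, hexy, hcx, hyd⟩ := exists_reachable_of_mem_edges (H := H) p hpe hep
    fun f hf hfe => (hH f).2 ⟨p.edges_subset_edgeSet hf, hfe, by rw [← hw]; exact hmin f hf⟩
  obtain ⟨τ, hτ⟩ := exists_gauge hG fun f => if f = e then (-1 : ℤˣ) else 1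
  refine ⟨fun v => τ v * σ₀ v, ?_, fun heq => ?_⟩
  · refine isGroundState_of_wall (H := H) hexy (fun f hfe => ?_) (fun f hf => ?_) ?_ ?_
    · rw [← hσ₀ f]
      congr 1
      obtain ⟨f, hf⟩ := f
      induction f with
      | _ a b =>
        have h1 := hτ a b hf
        rw [if_neg (fun h => hfe (Subtype.ext h))] at h1
        rw [edgeSpin_mk, edgeSpin_mk, mul_mul_mul_comm, h1, one_mul]
    · obtain ⟨h1, h2, h3⟩ := (hH f).1 hf
      exact ⟨h1, fun h => h2 (congrArg Subtype.val h), by rwa [hw ⟨f, h1⟩] at h3⟩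
    · exact hc.mono fun z hz => hcx.symm.trans (SimpleGraph.Reachable.mono hle hz)
    · exact hd.mono fun z hz => hyd.trans (SimpleGraph.Reachable.mono hle hz)
  -- The path crosses e exactly once, so τ differs at c and d.
  · have h1 := mul_eq_prod_edges (h := fun f => if f = e then (-1 : ℤˣ) else 1) hτ p
    rw [prod_map_ite_eq_neg_one hpe hep] at h1
    simp only [mul_assoc, Int.units_mul_self, mul_one] at heq
    rw [heq, Int.units_mul_self] at h1
    exact absurd h1 (by decide)

/-- Finitely many ground states would give finitely many sign vectors (σ(c)σ₀(c))_σ, yet separation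
makes these vectors distinct for distinct c in I. -/
theorem infinite_groundStates {G : SimpleGraph V} [G.LocallyFinite] (hG : G.IsTree)
    {J : G.edgeSet → ℝ} {δ : ℝ} {I : Set V} (hI : I.Infinite)
    (hinf : ∀ c ∈ I, {z | (openSubgraph G (strongEdges δ J)).Reachable c z}.Infinite)
    (hdisj : I.Pairwise fun c d => ¬ (openSubgraph G (strongEdges δ J)).Reachable c d) :
    (groundStates G J).Infinite := by
  classical
  obtain ⟨σ₀, h₀⟩ := exists_gauge hG
    fun f => if hf : f ∈ G.edgeSet then (if 0 ≤ J ⟨f, hf⟩ then (1 : ℤˣ) else -1) else 1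
  have hσ₀ : ∀ f, J f * edgeSpin σ₀ f = |J f| := by
    rintro ⟨f, hf⟩
    induction f with
    | _ a b =>
      rw [edgeSpin_mk, h₀ a b hf, dif_pos hf]
      split_ifs with h
      · simp [abs_of_nonneg h]
      · simp [abs_of_neg (not_le.1 h)]
  intro hfin
  have := hfin.to_subtype
  have := hI.to_subtype
  refine not_injective_infinite_finite
    (fun (c : I) (σ : groundStates G J) => σ.1 c * σ₀ c) fun c d hcd => ?_
  by_contra hne
  obtain ⟨σ, hσ, hσcd⟩ := exists_groundState_separating hG hσ₀ (hinf c c.2) (hinf d d.2)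
    (hdisj c.2 d.2 fun h => hne (Subtype.ext h))
  exact hσcd (congrFun hcd ⟨σ, hσ⟩)

/-! ### Zero-one law and preliminaries on locally finite graphs -/

/-- An event of a product space that is invariant under changes of finitely many coordinates has
probability zero or one. -/
theorem measure_eq_zero_or_one_of_finite_change {ι X : Type*} [MeasurableSpace X] [Nonempty X]
    {μ : ι → Measure X} [∀ i, IsProbabilityMeasure (μ i)] {A : Set (ι → X)}
    (hA : MeasurableSet A)
    (hinv : ∀ ω ω' : ι → X, {i | ω i ≠ ω' i}.Finite → ω ∈ A → ω' ∈ A) :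
    Measure.infinitePi μ A = 0 ∨ Measure.infinitePi μ A = 1 := by
  classical
  obtain ⟨x₀⟩ := ‹Nonempty X›
  have hind : iIndep (fun i => MeasurableSpace.comap (fun ω : ι → X => ω i) inferInstance)
      (Measure.infinitePi μ) :=
    iIndepFun_infinitePi (P := μ) (X := fun _ x => x) fun _ => measurable_id
  refine measure_zero_or_one_of_measurableSet_limsup (p := Set.Finite) (f := Filter.cofinite)
    (ns := fun s : Finset ι => (s : Set ι)) (fun i => (measurable_pi_apply i).comap_le) hind
    (fun t ht => by simpa using ht)
    (fun s t => ⟨s ∪ t, by simp, by simp⟩) (fun s => s.finite_toSet)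
    (fun i => ⟨{i}, by simp⟩) ?_
  rw [Filter.limsup_eq_iInf_iSup, MeasurableSpace.measurableSet_iInf]
  intro t
  rw [MeasurableSpace.measurableSet_iInf]
  intro ht
  -- Resetting the finitely many coordinates outside t does not affect A, so A is measurable with
  -- respect to the coordinates in t: it is a tail event.
  let φ : (ι → X) → ι → X := fun ω i => if i ∈ t then ω i else x₀
  have hφfin : ∀ ω, {i | ω i ≠ φ ω i}.Finite := fun ω =>
    (Filter.mem_cofinite.1 ht).subset fun i hi hit => hi (by simp [φ, hit])
  have hφA : A = φ ⁻¹' A := by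
    ext ω
    refine ⟨hinv _ _ (hφfin ω), hinv _ _ ?_⟩
    simpa only [ne_comm] using hφfin ω
  have hφ : @Measurable _ _
      (⨆ i ∈ t, MeasurableSpace.comap (fun ω : ι → X => ω i) inferInstance) _ φ := by
    refine @measurable_pi_lambda _ _ _ (_) _ _ fun i => ?_
    by_cases hi : i ∈ t
    · simp only [φ, hi, if_true]
      exact Measurable.of_comap_le (le_iSup₂_of_le i hi le_rfl)
    · simp only [φ, hi, if_false]
      exact @measurable_const _ _ (_) _ _
  rw [hφA]
  exact hφ hA

instance (G : SimpleGraph V) (p : unitInterval) : IsProbabilityMeasure (percolationLaw G p) := by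
  unfold percolationLaw
  infer_instance

theorem percolationLaw_forall_open {G : SimpleGraph V} {p : unitInterval} (hp : p < 1)
    {e : ℕ → G.edgeSet} (he : Function.Injective e) :
    percolationLaw G p {ω | ∀ n, ω (e n) = true} = 0 := by
  have hlt : bernoulliMeasure true false p {true} < 1 := by
    rw [bernoulliMeasure_apply p (measurableSet_singleton _)]
    have h : unitInterval.toNNReal p < 1 := NNReal.coe_lt_coe.1 (show (p : ℝ) < 1 from hp)
    simpa using h
  refine le_antisymm (ge_of_tendsto' (ENNReal.tendsto_pow_atTop_nhds_zero_of_lt_one hlt)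
    fun n => ?_) zero_le
  have h := Measure.infinitePi_pi (fun _ : G.edgeSet => bernoulliMeasure true false p)
    (s := (Finset.range n).map ⟨e, he⟩) (t := fun _ => {true})
    fun _ _ => measurableSet_singleton _
  rw [Finset.prod_const, Finset.card_map, Finset.card_range] at h
  rw [← h]
  refine measure_mono fun ω hω i hi => ?_
  obtain ⟨k, -, rfl⟩ := Finset.mem_map.1 hi
  exact hω k

theorem finite_setOf_walk_length (G : SimpleGraph V) [G.LocallyFinite] (n : ℕ) (r : V) :
    {v | ∃ p : G.Walk r v, p.length = n}.Finite := by
  induction n generalizing r with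
  | zero =>
    refine (finite_singleton r).subset ?_
    rintro v ⟨p, hp⟩
    exact (SimpleGraph.Walk.eq_of_length_eq_zero hp).symm
  | succ n ih =>
    refine ((G.neighborSet r).toFinite.biUnion fun w _ => ih w).subset ?_
    rintro v ⟨p, hp⟩
    cases p with
    | nil => simp at hp
    | @cons _ w _ h q =>
      exact mem_biUnion (show w ∈ G.neighborSet r from h) ⟨q, by simpa using hp⟩

theorem finite_setOf_dist_le {G : SimpleGraph V} [G.LocallyFinite] (hG : G.Connected) (r : V)
    (n : ℕ) : {v | G.dist r v ≤ n}.Finite := by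
  refine ((finite_Iic n).biUnion fun k _ => finite_setOf_walk_length G k r).subset fun v hv => ?_
  exact mem_biUnion (show G.dist r v ∈ Iic n from hv) (hG.exists_walk_length_eq_dist r v)

theorem countable_of_connected {G : SimpleGraph V} [G.LocallyFinite] (hG : G.Connected) :
    Countable V := by
  obtain ⟨r⟩ := hG.nonempty
  rw [← countable_univ_iff]
  refine (countable_iUnion fun n => (finite_setOf_dist_le hG r n).countable).mono fun v _ => ?_
  exact mem_iUnion.2 ⟨G.dist r v, le_refl (G.dist r v)⟩

/-! ### The rooted tree -/

/-- `w` is a child of `v` in the tree `G` rooted at `r`. -/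
def Child (G : SimpleGraph V) (r v w : V) : Prop :=
  G.Adj v w ∧ G.dist r w = G.dist r v + 1

/-- `w` is a descendant of `v` in the tree `G` rooted at `r`. -/
def Below (G : SimpleGraph V) (r : V) : V → V → Prop :=
  Relation.ReflTransGen (Child G r)

theorem Below.dist_le {G : SimpleGraph V} {r v w : V} (h : Below G r v w) :
    G.dist r v ≤ G.dist r w := by
  induction h with
  | refl => exact le_rfl
  | tail _ h ih => exact ih.trans (h.2.symm ▸ Nat.le_succ _)

/-- Any parent of w is the penultimate vertex of the path from the root to w. -/
theorem Child.parent_unique {G : SimpleGraph V} (hG : G.IsTree) {r u v w : V}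
    (hu : Child G r u w) (hv : Child G r v w) : u = v := by
  obtain ⟨q, hq, hql⟩ := hG.connected.exists_path_of_dist r w
  have key : ∀ x, Child G r x w → x = q.penultimate := by
    intro x hx
    obtain ⟨p, hp, hpl⟩ := hG.connected.exists_path_of_dist r x
    by_cases hmem : x ∈ q.support
    · rw [hG.isAcyclic.path_concat hp hq hx.1 hmem, SimpleGraph.Walk.penultimate_concat]
    · have h1 := hG.isAcyclic.mem_support_of_ne_mem_support_of_adj_of_isPath hp hq hx.1 hmem
      have h2 := congrArg SimpleGraph.Walk.length (hG.isAcyclic.path_concat hq hp hx.1.symm h1)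
      rw [SimpleGraph.Walk.length_concat, hpl, hql, hx.2] at h2
      omega
  rw [key u hu, key v hv]

theorem Below.eq_of_dist_eq {G : SimpleGraph V} (hG : G.IsTree) {r a b z : V}
    (ha : Below G r a z) (hb : Below G r b z) (hab : G.dist r a = G.dist r b) : a = b := by
  induction ha with
  | refl =>
    rcases Relation.ReflTransGen.cases_tail hb with h | ⟨c, hc, hcz⟩
    · exact h
    · have h1 := Below.dist_le hc
      have h2 := hcz.2
      omega
  | @tail y z hay hyz ih =>
    rcases Relation.ReflTransGen.cases_tail hb with h | ⟨c, hc, hcz⟩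
    · subst h
      have h1 := Below.dist_le hay
      have h2 := hyz.2
      omega
    · rw [← hyz.parent_unique hG hcz] at hc
      exact ih hc

/-- An edge leaving the set of descendants of `b` joins `b` to its parent. -/
theorem Below.eq_of_adj_of_not_below {G : SimpleGraph V} (hG : G.IsTree) {r a b x y : V}
    (hab : Child G r a b) (hx : Below G r b x) (hy : ¬ Below G r b y) (hxy : G.Adj x y) :
    x = b ∧ y = a := by
  rcases hG.dist_eq_dist_add_one_of_adj r hxy with h | h
  · have hyx : Child G r y x := ⟨hxy.symm, h⟩
    rcases Relation.ReflTransGen.cases_tail hx with h | ⟨c, hc, hcx⟩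
    · subst h
      exact ⟨rfl, hyx.parent_unique hG hab⟩
    · rw [← hyx.parent_unique hG hcx] at hc
      exact absurd hc hy
  · exact absurd (Relation.ReflTransGen.tail hx ⟨hxy, h⟩) hy

/-! ### Descending open paths -/

theorem openSubgraph_adj {G : SimpleGraph V} {ω : G.edgeSet → Bool} {v w : V} :
    (openSubgraph G ω).Adj v w ↔ ∃ h : G.Adj v w, ω ⟨s(v, w), h⟩ = true := by
  rw [← SimpleGraph.mem_edgeSet, mem_edgeSet_openSubgraph]
  rfl

theorem openSubgraph_le (G : SimpleGraph V) (ω : G.edgeSet → Bool) : openSubgraph G ω ≤ G :=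
  fun _ _ h => (openSubgraph_adj.1 h).1

/-- A descending open path of length `n` starts at `v`, in the tree `G` rooted at `r`. -/
def Descends (G : SimpleGraph V) (r : V) (ω : G.edgeSet → Bool) : ℕ → V → Prop
  | 0, _ => True
  | n + 1, v => ∃ w, (openSubgraph G ω).Adj v w ∧ G.dist r w = G.dist r v + 1 ∧
      Descends G r ω n w

/-- Arbitrarily long descending open paths start at `v`. -/
def DescendsForever (G : SimpleGraph V) (r : V) (ω : G.edgeSet → Bool) (v : V) : Prop :=
  ∀ n, Descends G r ω n v

theorem Descends.of_succ {G : SimpleGraph V} {r : V} {ω : G.edgeSet → Bool} {n : ℕ} {v : V}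
    (h : Descends G r ω (n + 1) v) : Descends G r ω n v := by
  induction n generalizing v with
  | zero => trivial
  | succ n ih =>
    obtain ⟨w, h1, h2, h3⟩ := h
    exact ⟨w, h1, h2, ih h3⟩

theorem Descends.anti {G : SimpleGraph V} {r : V} {ω : G.edgeSet → Bool} {m n : ℕ} {v : V}
    (h : Descends G r ω n v) (hmn : m ≤ n) : Descends G r ω m v := by
  induction hmn with
  | refl => exact h
  | step _ ih => exact ih h.of_succ

/-- A descent never returns above its starting level. Hence changing finitely many edges is not felt
far from the root. -/
theorem Descends.congr {G : SimpleGraph V} {r : V} {ω ω' : G.edgeSet → Bool} {n : ℕ} {v : V}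
    (h : Descends G r ω n v)
    (hω : ∀ e : G.edgeSet, (∀ a ∈ (e : Sym2 V), G.dist r v ≤ G.dist r a) → ω e = ω' e) :
    Descends G r ω' n v := by
  induction n generalizing v with
  | zero => trivial
  | succ n ih =>
    obtain ⟨w, h1, h2, h3⟩ := h
    obtain ⟨hvw, h1⟩ := openSubgraph_adj.1 h1
    refine ⟨w, openSubgraph_adj.2 ⟨hvw, ?_⟩, h2, ih h3 fun e he => hω e fun a ha => ?_⟩
    · rw [← hω, h1]
      intro a ha
      rcases Sym2.mem_iff.1 ha with rfl | rfl <;> omega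
    · have := he a ha
      omega

theorem Descends.exists_reachable {G : SimpleGraph V} {r : V} {ω : G.edgeSet → Bool} {n : ℕ}
    {v : V} (h : Descends G r ω n v) :
    ∃ z, (openSubgraph G ω).Reachable v z ∧ G.dist r z = G.dist r v + n := by
  induction n generalizing v with
  | zero => exact ⟨v, .rfl, rfl⟩
  | succ n ih =>
    obtain ⟨w, h1, h2, h3⟩ := h
    obtain ⟨z, hz, hd⟩ := ih h3
    exact ⟨z, h1.reachable.trans hz, by omega⟩

theorem DescendsForever.infinite {G : SimpleGraph V} {r : V} {ω : G.edgeSet → Bool} {v : V}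
    (h : DescendsForever G r ω v) : {z | (openSubgraph G ω).Reachable v z}.Infinite := by
  choose z hz hd using fun n => (h n).exists_reachable
  refine infinite_of_injective_forall_mem (f := z) (fun m n hmn => ?_) hz
  have h1 := hd m
  rw [hmn, hd n] at h1
  omega

/-- König's lemma: if every open child failed at some depth, the maximum over the finitely many
neighbours would bound the descents from v. -/
theorem DescendsForever.exists_child {G : SimpleGraph V} [G.LocallyFinite] {r : V}
    {ω : G.edgeSet → Bool} {v : V} (h : DescendsForever G r ω v) :
    ∃ w, (openSubgraph G ω).Adj v w ∧ Child G r v w ∧ DescendsForever G r ω w := by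
  by_contra! hcon
  have hex : ∀ w, ∃ n, (openSubgraph G ω).Adj v w → Child G r v w → ¬ Descends G r ω n w := by
    intro w
    by_cases h1 : (openSubgraph G ω).Adj v w ∧ Child G r v w
    · obtain ⟨n, hn⟩ := not_forall.1 (hcon w h1.1 h1.2)
      exact ⟨n, fun _ _ => hn⟩
    · exact ⟨0, fun a b => absurd ⟨a, b⟩ h1⟩
  choose n hn using hex
  obtain ⟨w, h1, h2, h3⟩ := h ((G.neighborFinset v).sup n + 1)
  have hvw := openSubgraph_le G ω h1
  exact hn w h1 ⟨hvw, h2⟩ (h3.anti (Finset.le_sup ((G.mem_neighborFinset v w).2 hvw)))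

theorem DescendsForever.exists_below {G : SimpleGraph V} [G.LocallyFinite] {r : V}
    {ω : G.edgeSet → Bool} {v : V} (h : DescendsForever G r ω v) (n : ℕ) :
    ∃ w, Below G r v w ∧ G.dist r w = G.dist r v + n ∧ DescendsForever G r ω w := by
  induction n with
  | zero => exact ⟨v, .refl, rfl, h⟩
  | succ n ih =>
    obtain ⟨w, h1, h2, h3⟩ := ih
    obtain ⟨u, -, h4, h5⟩ := h3.exists_child
    exact ⟨u, h1.tail h4, by rw [h4.2, h2, add_assoc], h5⟩

/-- The distance to r grows by at most one per step, so equality forces every step to descend. -/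
theorem descends_of_walk {G : SimpleGraph V} (hG : G.Connected) {r : V} {ω : G.edgeSet → Bool}
    {v z : V} (q : (openSubgraph G ω).Walk v z) (hq : G.dist r z = G.dist r v + q.length) :
    Descends G r ω q.length v := by
  induction q with
  | nil => trivial
  | @cons v w z h q ih =>
    rw [SimpleGraph.Walk.length_cons] at hq ⊢
    have hvw := SimpleGraph.dist_eq_one_iff_adj.2 (openSubgraph_le G ω h)
    have h1 := hG.dist_triangle (u := r) (v := v) (w := w)
    have h2 := hG.dist_triangle (u := r) (v := w) (w := z)
    have h3 := SimpleGraph.dist_le (q.mapLe (openSubgraph_le G ω))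
    rw [SimpleGraph.Walk.length_map] at h3
    exact ⟨w, h, by omega, ih (by omega)⟩

/-- By local finiteness an infinite cluster reaches every distance, and an open path from r is the
unique tree path, hence a geodesic. -/
theorem descendsForever_root {G : SimpleGraph V} [G.LocallyFinite] (hG : G.IsTree) {r : V}
    {ω : G.edgeSet → Bool} (h : {z | (openSubgraph G ω).Reachable r z}.Infinite) :
    DescendsForever G r ω r := by
  intro n
  obtain ⟨z, hz, hn⟩ := h.exists_notMem_finite (finite_setOf_dist_le hG.connected r n)
  obtain ⟨q, hq⟩ := SimpleGraph.Reachable.exists_isPath hz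
  obtain ⟨p, hp, hpl⟩ := hG.connected.exists_path_of_dist r z
  have hqp : q.mapLe (openSubgraph_le G ω) = p :=
    (hG.existsUnique_path r z).unique (hq.mapLe _) hp
  have hlen : q.length = G.dist r z := by
    rw [← hpl, ← hqp, SimpleGraph.Walk.length_map]
  refine (descends_of_walk hG.connected q ?_).anti ?_
  · rw [hlen, SimpleGraph.dist_self, zero_add]
  · rw [hlen]
    exact (not_le.1 hn).le

theorem measurableSet_openSubgraph_adj (G : SimpleGraph V) (v w : V) :
    MeasurableSet {ω | (openSubgraph G ω).Adj v w} := by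
  by_cases h : G.Adj v w
  · simp only [openSubgraph_adj, h, exists_true_left]
    exact measurableSet_eq_fun (measurable_pi_apply _) measurable_const
  · simp [openSubgraph_adj, h]

theorem measurableSet_descends [Countable V] (G : SimpleGraph V) (r : V) (n : ℕ) (v : V) :
    MeasurableSet {ω | Descends G r ω n v} := by
  induction n generalizing v with
  | zero => exact MeasurableSet.univ
  | succ n ih =>
    simp only [Descends, ofPred_exists]
    exact MeasurableSet.iUnion fun w => (measurableSet_openSubgraph_adj G v w).inter
      ((MeasurableSet.const _).inter (ih w))

theorem measurableSet_descendsForever [Countable V] (G : SimpleGraph V) (r v : V) :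
    MeasurableSet {ω | DescendsForever G r ω v} := by
  simp only [DescendsForever, ofPred_forall]
  exact MeasurableSet.iInter fun n => measurableSet_descends G r n v

/-! ### Fat vertices and infinitely many infinite clusters -/

/-- With positive probability, arbitrarily long descending open paths start at `v`. -/
def Fat (G : SimpleGraph V) (r : V) (p : unitInterval) (v : V) : Prop :=
  percolationLaw G p {ω | DescendsForever G r ω v} ≠ 0

theorem ae_fat_of_descendsForever [Countable V] (G : SimpleGraph V) (r : V) (p : unitInterval) :
    ∀ᵐ ω ∂percolationLaw G p, ∀ v, DescendsForever G r ω v → Fat G r p v := by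
  rw [ae_all_iff]
  intro v
  by_cases h : Fat G r p v
  · simp [h]
  · filter_upwards [measure_eq_zero_iff_ae_notMem.1 (not_not.1 h)] with ω hω hd
    exact absurd hd hω

theorem Fat.exists_child {G : SimpleGraph V} [G.LocallyFinite] [Countable V] {r : V}
    {p : unitInterval} {v : V} (h : Fat G r p v) : ∃ w, Child G r v w ∧ Fat G r p w := by
  obtain ⟨ω, hω, hfat⟩ := ((frequently_ae_iff.2 h).and_eventually
    (ae_fat_of_descendsForever G r p)).exists
  obtain ⟨w, -, hw, hd⟩ := hω.exists_child
  exact ⟨w, hw, hfat w hd⟩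

/-- Below a fat vertex there is almost surely an infinite descending open path. -/
theorem Fat.ae_exists_below {G : SimpleGraph V} [G.LocallyFinite] [Countable V] {r : V}
    {p : unitInterval} {v : V} (h : Fat G r p v) :
    ∀ᵐ ω ∂percolationLaw G p, ∃ x, Below G r v x ∧ DescendsForever G r ω x := by
  have hm : MeasurableSet {ω | ∃ x, Below G r v x ∧ DescendsForever G r ω x} := by
    simp only [ofPred_exists]
    exact MeasurableSet.iUnion fun x => (MeasurableSet.const _).inter
      (measurableSet_descendsForever G r x)
  have h01 := measure_eq_zero_or_one_of_finite_change
    (μ := fun _ : G.edgeSet => bernoulliMeasure true false p) hm ?_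
  · rcases h01 with h0 | h1
    · exact absurd (measure_mono_null (fun ω hω => (⟨v, .refl, hω⟩ :
        ∃ x, Below G r v x ∧ DescendsForever G r ω x)) h0) h
    · exact (prob_compl_eq_zero_iff hm).2 h1
  · rintro ω ω' hfin ⟨x, hvx, hx⟩
    -- Every changed edge has an end at level at most N, so a descent starting at level above N uses
    -- none of them.
    obtain ⟨N, hN⟩ := (hfin.image fun e : G.edgeSet => G.dist r (e : Sym2 V).out.1).bddAbove
    obtain ⟨y, hxy, hyd, hy⟩ := hx.exists_below (N + 1)
    refine ⟨y, Relation.ReflTransGen.trans hvx hxy, fun n => (hy n).congr fun e he => ?_⟩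
    by_contra hne
    have h1 := hN (mem_image_of_mem _ hne)
    have h2 := he _ (Sym2.out_fst_mem _)
    omega

theorem injective_edges_of_strictMono_dist {G : SimpleGraph V} {r : V} {x y : ℕ → V}
    (hxy : ∀ n, Child G r (x n) (y n)) (hmono : StrictMono fun n => G.dist r (y n)) :
    Function.Injective fun n => (⟨s(x n, y n), (hxy n).1⟩ : G.edgeSet) := by
  intro m n hmn
  refine hmono.injective ?_
  have hx := hxy m
  have hy := hxy n
  rcases Sym2.eq_iff.1 (congrArg Subtype.val hmn) with ⟨-, h2⟩ | ⟨h1, h2⟩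
  · exact congrArg (G.dist r) h2
  · have h3 := hx.2
    have h4 := hy.2
    rw [h1, h2] at h3
    omega

/-- Below a fat vertex there is a vertex with two fat children: otherwise the fat vertices below it
form a single ray, and almost surely some edge of this ray is closed. -/
theorem Fat.exists_two_children {G : SimpleGraph V} [G.LocallyFinite] [Countable V] {r : V}
    {p : unitInterval} (hp : p < 1) {v : V} (h : Fat G r p v) :
    ∃ x a b, Below G r v x ∧ Child G r x a ∧ Child G r x b ∧ a ≠ b ∧ Fat G r p a ∧
      Fat G r p b := by
  by_contra! hcon
  choose c hc hcfat using fun w : {w // Below G r v w ∧ Fat G r p w} => w.2.2.exists_child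
  let x : ℕ → {w // Below G r v w ∧ Fat G r p w} :=
    fun n => Nat.rec ⟨v, .refl, h⟩ (fun _ w => ⟨c w, w.2.1.tail (hc w), hcfat w⟩) n
  have hx : ∀ n, Child G r (x n).1 (x (n + 1)).1 := fun n => hc (x n)
  have hinj := injective_edges_of_strictMono_dist (x := fun n => (x n).1)
    (y := fun n => (x (n + 1)).1) hx
    (strictMono_nat_of_lt_succ fun n => by rw [(hx (n + 1)).2]; exact Nat.lt_succ_self _)
  refine h (measure_mono_null_ae ?_ (percolationLaw_forall_open hp hinj))
  filter_upwards [ae_fat_of_descendsForever G r p] with ω hω hv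
  -- Almost surely an infinite descent passes through fat vertices only, and without branching the
  -- next one is forced to be on the ray.
  have key : ∀ n, DescendsForever G r ω (x n).1 →
      (openSubgraph G ω).Adj (x n).1 (x (n + 1)).1 ∧ DescendsForever G r ω (x (n + 1)).1 := by
    intro n hn
    obtain ⟨w, h1, h2, h3⟩ := hn.exists_child
    have : w = (x (n + 1)).1 := by
      by_contra hne
      exact hcon (x n).1 w (x (n + 1)).1 (x n).2.1 h2 (hx n) hne (hω w h3) (x (n + 1)).2.2
    exact this ▸ ⟨h1, h3⟩
  have hall : ∀ n, DescendsForever G r ω (x n).1 := by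
    intro n
    induction n with
    | zero => exact hv
    | succ n ih => exact (key n ih).2
  exact fun n => (openSubgraph_adj.1 (key n (hall n)).1).2

/-- Fat vertices with disjoint sets of descendants. -/
theorem Fat.exists_seq {G : SimpleGraph V} [G.LocallyFinite] [Countable V] (hG : G.IsTree) {r : V}
    {p : unitInterval} (hp : p < 1) (h : Fat G r p r) :
    ∃ x b : ℕ → V, (∀ n, Child G r (x n) (b n)) ∧ (∀ n, Fat G r p (b n)) ∧
      (StrictMono fun n => G.dist r (b n)) ∧
      ∀ m n, m < n → ∀ z, Below G r (b n) z → ¬ Below G r (b m) z := by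
  choose x a b hx ha hb hab hafat hbfat using
    fun w : {w // Fat G r p w} => w.2.exists_two_children hp
  -- The construction continues below the fat child a and sets its sibling b aside; all later b's
  -- lie below a.
  let s : ℕ → {w // Fat G r p w} := fun n => Nat.rec ⟨r, h⟩ (fun _ w => ⟨a w, hafat w⟩) n
  have hs : ∀ n, (s (n + 1)).1 = a (s n) := fun n => rfl
  have hsb : ∀ n, Below G r (s n).1 (b (s n)) := fun n => (hx (s n)).tail (hb (s n))
  have hss : ∀ m n, m ≤ n → Below G r (s m).1 (s n).1 := by
    intro m n hmn
    induction hmn with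
    | refl => exact .refl
    | step _ ih => exact ih.trans ((hx _).tail (ha _))
  refine ⟨fun n => x (s n), fun n => b (s n), fun n => hb (s n), fun n => hbfat (s n),
    strictMono_nat_of_lt_succ fun n => ?_, fun m n hmn z hz hz' => ?_⟩
  · have h1 := (hb (s n)).2
    have h2 := (ha (s n)).2
    have h3 := (hb (s (n + 1))).2
    have h4 := (hx (s (n + 1))).dist_le
    rw [hs] at h4
    change G.dist r (b (s n)) < G.dist r (b (s (n + 1)))
    omega
  · have h1 : Below G r (a (s m)) z := ((hss (m + 1) n hmn).trans (hsb n)).trans hz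
    exact hab (s m) (h1.eq_of_dist_eq hG hz' (by rw [(ha (s m)).2, (hb (s m)).2]))

/-- In the supercritical phase with `p < 1` there are almost surely infinitely many infinite
clusters. -/
theorem ae_exists_infinite_clusters {G : SimpleGraph V} [G.LocallyFinite] (hG : G.IsTree)
    {p : unitInterval} (hp : p < 1) (h : percolationLaw G p {ω | HasInfiniteCluster G ω} ≠ 0) :
    ∀ᵐ ω ∂percolationLaw G p, ∃ I : Set V, I.Infinite ∧
      (∀ c ∈ I, {z | (openSubgraph G ω).Reachable c z}.Infinite) ∧
      I.Pairwise fun c d => ¬ (openSubgraph G ω).Reachable c d := by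
  have := countable_of_connected hG.connected
  obtain ⟨r, hr⟩ : ∃ r, percolationLaw G p
      {ω | {z | (openSubgraph G ω).Reachable r z}.Infinite} ≠ 0 := by
    by_contra! hcon
    refine h (measure_mono_null ?_ (measure_iUnion_null hcon))
    rintro ω ⟨r, hr⟩
    exact mem_iUnion.2 ⟨r, hr⟩
  have hfat : Fat G r p r := fun h0 =>
    hr (measure_mono_null (fun ω hω => descendsForever_root hG hω) h0)
  obtain ⟨x, b, hxb, hb, hmono, hdisj⟩ := hfat.exists_seq hG hp
  have hinj := injective_edges_of_strictMono_dist hxb hmono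
  have hclosed : ∀ᵐ ω ∂percolationLaw G p, ∀ m, ∃ n,
      ω ⟨s(x (n + m), b (n + m)), (hxb (n + m)).1⟩ ≠ true := by
    rw [ae_all_iff]
    intro m
    filter_upwards [measure_eq_zero_iff_ae_notMem.1
      (percolationLaw_forall_open hp (hinj.comp (add_left_injective m)))] with ω hω
    exact not_forall.1 hω
  filter_upwards [hclosed, ae_all_iff.2 fun n => (hb n).ae_exists_below] with ω hω hy
  choose y hby hyd using hy
  let K : Set ℕ := {n | ω ⟨s(x n, b n), (hxb n).1⟩ ≠ true}
  have hK : K.Infinite := by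
    refine infinite_of_forall_exists_gt fun m => ?_
    obtain ⟨n, hn⟩ := hω (m + 1)
    exact ⟨n + (m + 1), hn, by omega⟩
  -- The only way out of the descendants of b m is the edge to x m, which is closed for m in K.
  have hyne : ∀ m n, m < n → m ∈ K → ¬ (openSubgraph G ω).Reachable (y m) (y n) := by
    rintro m n hmn hm ⟨q⟩
    obtain ⟨d, -, hd1, hd2⟩ := q.exists_boundary_dart {z | Below G r (b m) z} (hby m)
      (hdisj m n hmn _ (hby n))
    obtain ⟨hadj, hopen⟩ := openSubgraph_adj.1 d.adj
    obtain ⟨h1, h2⟩ := Below.eq_of_adj_of_not_below hG (hxb m) hd1 hd2 hadj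
    refine hm (Eq.trans (congrArg ω (Subtype.ext ?_)) hopen)
    exact Sym2.eq_iff.2 (.inr ⟨h2.symm, h1.symm⟩)
  have hyne' : ∀ m ∈ K, ∀ n ∈ K, m ≠ n → ¬ (openSubgraph G ω).Reachable (y m) (y n) := by
    intro m hm n hn hne
    rcases lt_or_gt_of_ne hne with hlt | hlt
    · exact hyne m n hlt hm
    · exact fun h => hyne n m hlt hn h.symm
  refine ⟨y '' K, hK.image fun m hm n hn hmn => ?_, ?_, ?_⟩
  · by_contra hne
    exact hyne' m hm n hn hne (hmn ▸ .rfl)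
  · rintro _ ⟨n, -, rfl⟩
    exact (hyd n).infinite
  · rintro _ ⟨m, hm, rfl⟩ _ ⟨n, hn, rfl⟩ hne
    exact hyne' m hm n hn fun h => hne (congrArg y h)

/-! ### Strong edges as Bernoulli percolation -/

theorem measurable_strongEdge (δ : ℝ) : Measurable fun x : ℝ => decide (δ ≤ |x|) :=
  measurable_to_bool (by
    have : (fun x : ℝ => decide (δ ≤ |x|)) ⁻¹' {true} = {x : ℝ | δ ≤ |x|} := by ext; simp
    rw [this]
    exact measurableSet_le measurable_const (by fun_prop))

theorem map_strongEdge_eq_bernoulliMeasure (ν : Measure ℝ) [IsProbabilityMeasure ν] (δ : ℝ) :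
    ν.map (fun x => decide (δ ≤ |x|)) =
      bernoulliMeasure true false ⟨ν.real {x | δ ≤ |x|}, measureReal_nonneg, measureReal_le_one⟩ := by
  have hm := measurable_strongEdge δ
  have := Measure.isProbabilityMeasure_map (μ := ν) hm.aemeasurable
  have key : ∀ (P : Measure Bool) [IsProbabilityMeasure P] (Q : Measure Bool)
      [IsProbabilityMeasure Q], P.real {true} = Q.real {true} → P = Q := by
    intro P _ Q _ h
    have hc : ({false} : Set Bool) = {true}ᶜ := by ext b; cases b <;> simp
    have hf : P.real {false} = Q.real {false} := by
      rw [hc, probReal_compl_eq_one_sub (measurableSet_singleton _),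
        probReal_compl_eq_one_sub (measurableSet_singleton _), h]
    refine Measure.ext_of_singleton fun b => ?_
    rw [← measureReal_eq_measureReal_iff]
    cases b
    · exact hf
    · exact h
  refine key _ _ ?_
  rw [map_measureReal_apply hm (measurableSet_singleton _),
    bernoulliMeasure_real_apply _ (measurableSet_singleton _)]
  simp [preimage]

theorem map_strongEdges_couplingLaw (G : SimpleGraph V) (ν : Measure ℝ) [IsProbabilityMeasure ν]
    (δ : ℝ) : (couplingLaw G ν).map (strongEdges δ) =
      percolationLaw G ⟨ν.real {x | δ ≤ |x|}, measureReal_nonneg, measureReal_le_one⟩ := by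
  have h := Measure.infinitePi_map_pi (fun _ : G.edgeSet => ν)
    (f := fun _ x => decide (δ ≤ |x|)) fun _ => measurable_strongEdge δ
  rw [percolationLaw, ← map_strongEdge_eq_bernoulliMeasure, ← h]
  rfl

/-- Continuity from below: the sets {|x| ≥ 1/(n+1)} increase to the complement of 0, which has full
mass. -/
theorem exists_lt_measureReal_le_abs {ν : Measure ℝ} [IsProbabilityMeasure ν] (hν0 : ν {0} = 0)
    {q : ℝ} (hq : q < 1) : ∃ δ > 0, q < ν.real {x | δ ≤ |x|} := by
  have hmono : Monotone fun n : ℕ => {x : ℝ | 1 / ((n : ℝ) + 1) ≤ |x|} :=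
    fun m n hmn x hx => (Nat.one_div_le_one_div hmn).trans (mem_ofPred_eq ▸ hx)
  have hU : ⋃ n : ℕ, {x : ℝ | 1 / ((n : ℝ) + 1) ≤ |x|} = {0}ᶜ := by
    ext x
    simp only [mem_iUnion, mem_ofPred_eq, mem_compl_iff, mem_singleton_iff]
    constructor
    · rintro ⟨n, hn⟩ rfl
      rw [abs_zero] at hn
      exact absurd hn (not_le.2 Nat.one_div_pos_of_nat)
    · intro hx
      obtain ⟨n, hn⟩ := exists_nat_one_div_lt (abs_pos.2 hx)
      exact ⟨n, hn.le⟩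
  have ht := tendsto_measure_iUnion_atTop (μ := ν) hmono
  rw [hU, (prob_compl_eq_one_iff (measurableSet_singleton _)).2 hν0] at ht
  have ht' := (ENNReal.tendsto_toReal ENNReal.one_ne_top).comp ht
  obtain ⟨n, hn⟩ := (ht'.eventually (lt_mem_nhds (by simpa using hq))).exists
  exact ⟨1 / ((n : ℝ) + 1), Nat.one_div_pos_of_nat, hn⟩

end SpinGlass

end

theorem mainTheorem7 {V : Type*} (G : SimpleGraph V) [G.LocallyFinite] (hG : G.IsTree)
    (hpc : SpinGlass.criticalProbability G < 1)
    (ν : Measure ℝ) [IsProbabilityMeasure ν]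
    (hν : ∀ ε : ℝ, 0 < ε → 0 < ν (Ioo (-ε) ε)) (hν0 : ν {0} = 0) :
    ∀ᵐ J ∂(SpinGlass.couplingLaw G ν), (SpinGlass.groundStates G J).Infinite := by
  obtain ⟨δ, hδ, hlt⟩ := SpinGlass.exists_lt_measureReal_le_abs hν0
    (show (SpinGlass.criticalProbability G : ℝ) < 1 from hpc)
  have hmap := SpinGlass.map_strongEdges_couplingLaw G ν δ
  set p : unitInterval := ⟨ν.real {x | δ ≤ |x|}, measureReal_nonneg, measureReal_le_one⟩
  -- The mass of ν near 0 keeps p below 1; without closed edges there would be only one cluster.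
  have hp1 : p < 1 := by
    refine lt_of_le_of_ne p.2.2 fun h => ?_
    have h1 : ν.real {x | δ ≤ |x|} = 1 := congrArg Subtype.val h
    have hm : MeasurableSet {x : ℝ | δ ≤ |x|} := measurableSet_le measurable_const (by fun_prop)
    have h2 : ν {x : ℝ | δ ≤ |x|}ᶜ = 0 := by
      rw [prob_compl_eq_zero_iff hm]
      exact (ENNReal.toReal_eq_one_iff _).1 h1
    refine (hν δ hδ).ne' (measure_mono_null (fun x hx => ?_) h2)
    exact not_le.2 (abs_lt.2 hx)
  have hperc : SpinGlass.percolationLaw G p {ω | SpinGlass.HasInfiniteCluster G ω} ≠ 0 :=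
    fun h0 => absurd (le_sSup (show p ∈ {p | SpinGlass.percolationLaw G p
      {ω | SpinGlass.HasInfiniteCluster G ω} = 0} from h0)) (not_le.2 hlt)
  have hae := SpinGlass.ae_exists_infinite_clusters hG hp1 hperc
  rw [← hmap] at hae
  have hmeas : Measurable (SpinGlass.strongEdges (G := G) δ) :=
    measurable_pi_lambda _ fun e =>
      (SpinGlass.measurable_strongEdge δ).comp (measurable_pi_apply e)
  filter_upwards [ae_of_ae_map hmeas.aemeasurable hae] with J hJ
  obtain ⟨I, hI, hinf, hdisj⟩ := hJ
  exact SpinGlass.infinite_groundStates hG hI hinf hdisj
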